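/- For a nonnegative integer $n$ let $s(n)$ be the sum of its binary digits. For every integer $t\ge 0$ the set $\{n\ge 0: s(n+t)\ge s(n)\}$ has an asymptotic density $$c_t=\lim_{N\to\infty}\frac1N\,\#\{0\le n<N: s(n+t)\ge s(n)\}.$$ For $j\ge 0$ let $t_j=(4^j-1)/3$; for $j\ge 1$ its binary representation is $t_j=\bigl((10)^{j-1}1\bigr)_2$. Then $$c_{t_j}=\frac12+\frac{\sqrt3}{4\sqrt{2\pi j}}+O\bigl(j^{-3/2}\bigr),$$ that is, there is an absolute constant $C$ such that $\left|c_{t_j}-\frac12-\frac{\sqrt3}{4\sqrt{2\pi j}}\right|\le C\,j^{-3/2}$ for all $j\ge 1$. Moreover, $c_{t_j}>\frac12$ for every $j\ge 1$. -/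

import Mathlib

open Filter Topology

/-- The binary sum-of-digits function `s`. -/
def binSum (n : ℕ) : ℕ := (Nat.digits 2 n).sum

/-- The set `A ⊆ ℕ` has asymptotic density `d`:
`#{n ∈ A : n < N} / N → d` as `N → ∞`. -/
def HasDensity (A : Set ℕ) (d : ℝ) : Prop :=
  Tendsto (fun N : ℕ => ((A ∩ Set.Iio N).ncard : ℝ) / (N : ℝ)) atTop (𝓝 d)

/-- The asymptotic density of `A ⊆ ℕ` (meaningful when the limit exists). -/
noncomputable def dens (A : Set ℕ) : ℝ :=
  limUnder atTop (fun N : ℕ => ((A ∩ Set.Iio N).ncard : ℝ) / (N : ℝ))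

/-- The set of `n ≥ 0` with `s(n + t) ≥ s(n)`. -/
def cusickSet (t : ℕ) : Set ℕ := {n : ℕ | binSum (n + t) ≥ binSum n}

/-- `c_t`, the asymptotic density of `{n ≥ 0 : s(n + t) ≥ s(n)}`. -/
noncomputable def cusickDensity (t : ℕ) : ℝ := dens (cusickSet t)

/-- `t_j = (4 ^ j - 1) / 3`. -/
def tSeq (j : ℕ) : ℕ := (4 ^ j - 1) / 3

/-- The subtraction and the division in `tSeq` are exact. -/
theorem three_mul_tSeq_add_one (j : ℕ) : 3 * tSeq j + 1 = 4 ^ j := by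
  have h : 4 ^ j % 3 = 1 := by
    rw [Nat.pow_mod]; norm_num
  unfold tSeq
  generalize 4 ^ j = m at h ⊢
  omega

/-- A density that exists is the value of `dens`. -/
theorem HasDensity.dens_eq {A : Set ℕ} {d : ℝ} (h : HasDensity A d) : dens A = d :=
  Tendsto.limUnder_eq h

/-! Splitting `n` by its last binary digit gives recursions for the density of `s(n + t) - s(n) ≥
k`. As `t_{j+1} = 4 t_j + 1`, they close up on `t_j` and `t_j + 1`; eliminating the latter leaves
the three-term recursion `tailDens_add_two`, invariant under `k ↦ -k` and solved by constants.
Everything follows from it and the values at `j = 0, 1`.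

Asymptotics: the even part of the tail density minus `1/2` obeys the same recursion, so its Fourier
transform satisfies `x_{j+2} = (1/4 + cos θ) x_{j+1} - x_j / 4`. At `θ = 0` the characteristic roots
are `1` and `1/4`. Near `0` the larger one is `1 - (2/3) θ² + O(θ⁴)`, and the transform is close to
`exp(-(2/3) j θ²) / 2`, with an error of integral `O(j^(-3/2))`. On the rest of the period both
roots have modulus at most `9/10`. Integrating over the period recovers `2π (c_{t_j} - 1/2)`, and
the Gaussian integral is the main term.

Positivity: sums over windows `-k, -k + 2, …, k` satisfy a similar recursion, whose negative term is
absorbed by the inequality in `symmSum_invariant`. -/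

/-! ### Binary digit sums -/

theorem binSum_two_mul (m : ℕ) : binSum (2 * m) = binSum m := by
  rcases Nat.eq_zero_or_pos m with rfl | h
  · simp
  · simp [binSum, Nat.digits_def' (b := 2) (by norm_num) (show 0 < 2 * m by omega)]

theorem binSum_two_mul_add_one (m : ℕ) : binSum (2 * m + 1) = binSum m + 1 := by
  rw [binSum, Nat.digits_def' (b := 2) (by norm_num) (show 0 < 2 * m + 1 by omega)]
  have h1 : (2 * m + 1) % 2 = 1 := by omega
  have h2 : (2 * m + 1) / 2 = m := by omega
  rw [h1, h2, List.sum_cons, binSum, add_comm]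

theorem binSum_succ_le (n : ℕ) : binSum (n + 1) ≤ binSum n + 1 := by
  induction n using Nat.strong_induction_on with
  | _ n ih =>
    rcases Nat.even_or_odd' n with ⟨m, rfl | rfl⟩
    · rw [binSum_two_mul_add_one, binSum_two_mul]
    · rw [show 2 * m + 1 + 1 = 2 * (m + 1) by ring, binSum_two_mul, binSum_two_mul_add_one]
      have := ih m (by omega)
      omega

/-! ### Asymptotic densities -/

open Classical in
theorem ncard_inter_Iio (A : Set ℕ) (N : ℕ) :
    (A ∩ Set.Iio N).ncard = Nat.count (· ∈ A) N := by
  rw [Nat.count_eq_card_filter_range, ← Set.ncard_coe_finset]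
  congr 1
  ext n
  simp [and_comm]

open Classical in
theorem count_interleave {A B C : Set ℕ} (hA : ∀ m, 2 * m ∈ C ↔ m ∈ A)
    (hB : ∀ m, 2 * m + 1 ∈ C ↔ m ∈ B) (M : ℕ) :
    Nat.count (· ∈ C) (2 * M) = Nat.count (· ∈ A) M + Nat.count (· ∈ B) M := by
  induction M with
  | zero => simp
  | succ M ih =>
    rw [show 2 * (M + 1) = 2 * M + 1 + 1 by ring, Nat.count_succ, Nat.count_succ, ih,
      Nat.count_succ, Nat.count_succ]
    simp only [hA, hB]
    ring

/-- The density of a set built from `A` on the even and `B` on the odd integers. -/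
theorem HasDensity.interleave {A B C : Set ℕ} {a b : ℝ} (ha : HasDensity A a)
    (hb : HasDensity B b) (hA : ∀ m, 2 * m ∈ C ↔ m ∈ A) (hB : ∀ m, 2 * m + 1 ∈ C ↔ m ∈ B) :
    HasDensity C ((a + b) / 2) := by
  classical
  unfold HasDensity at *
  simp only [ncard_inter_Iio] at *
  have hhalf : Tendsto (fun N : ℕ => N / 2) atTop atTop :=
    tendsto_atTop_atTop.2 fun n => ⟨2 * n, fun m hm => by omega⟩
  have hinv : Tendsto (fun N : ℕ => (1 : ℝ) / N) atTop (𝓝 0) := tendsto_one_div_atTop_nhds_zero_nat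
  have hratio : Tendsto (fun N : ℕ => ((N / 2 : ℕ) : ℝ) / N) atTop (𝓝 (1 / 2)) := by
    have hlow : Tendsto (fun N : ℕ => 1 / 2 - (1 : ℝ) / N) atTop (𝓝 (1 / 2)) := by
      simpa using tendsto_const_nhds.sub hinv
    refine tendsto_of_tendsto_of_tendsto_of_le_of_le' hlow tendsto_const_nhds ?_ ?_
    · filter_upwards [eventually_gt_atTop 0] with N hN
      have hN' : (0 : ℝ) < N := by exact_mod_cast hN
      have : (N : ℝ) ≤ 2 * (N / 2 : ℕ) + 1 := by exact_mod_cast (by omega : N ≤ 2 * (N / 2) + 1)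
      rw [le_div_iff₀ hN', sub_mul, div_mul_cancel₀ _ hN'.ne']
      linarith
    · filter_upwards [eventually_gt_atTop 0] with N hN
      have hN' : (0 : ℝ) < N := by exact_mod_cast hN
      have : 2 * ((N / 2 : ℕ) : ℝ) ≤ N := by exact_mod_cast (by omega : 2 * (N / 2) ≤ N)
      rw [div_le_iff₀ hN']
      linarith
  have hmain := ((ha.comp hhalf).add (hb.comp hhalf)).mul hratio
  rw [show (a + b) / 2 = (a + b) * (1 / 2) by ring]
  have hup := hmain.add hinv
  rw [add_zero] at hup
  -- Counting below `N` instead of `2 * (N / 2)` changes the count by at most one.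
  refine tendsto_of_tendsto_of_tendsto_of_le_of_le' hmain hup ?_ ?_ <;>
  · filter_upwards [eventually_ge_atTop 2] with N hN
    have hN' : (0 : ℝ) < N := by exact_mod_cast (by omega : 0 < N)
    have hM : (0 : ℝ) < (N / 2 : ℕ) := by exact_mod_cast (by omega : 0 < N / 2)
    have key : (((Nat.count (· ∈ A) (N / 2) : ℕ) : ℝ) / (N / 2 : ℕ) +
        ((Nat.count (· ∈ B) (N / 2) : ℕ) : ℝ) / (N / 2 : ℕ)) * (((N / 2 : ℕ) : ℝ) / N) =
        ((Nat.count (· ∈ C) (2 * (N / 2)) : ℕ) : ℝ) / N := by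
      rw [count_interleave hA hB]
      push_cast
      field_simp
    simp only [Function.comp_apply]
    rw [key]
    try rw [← add_div]
    have hlo : Nat.count (· ∈ C) (2 * (N / 2)) ≤ Nat.count (· ∈ C) N :=
      Nat.count_monotone _ (by omega)
    have hhi : Nat.count (· ∈ C) N ≤ Nat.count (· ∈ C) (2 * (N / 2)) + 1 := by
      have h1 : Nat.count (· ∈ C) N ≤ Nat.count (· ∈ C) (2 * (N / 2) + 1) :=
        Nat.count_monotone _ (by omega)
      rw [Nat.count_succ] at h1
      split_ifs at h1 <;> omega
    refine div_le_div_of_nonneg_right ?_ hN'.le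
    first | exact_mod_cast hlo | exact_mod_cast hhi

theorem hasDensity_empty : HasDensity ∅ 0 := by
  simp [HasDensity]

theorem hasDensity_univ : HasDensity Set.univ 1 := by
  unfold HasDensity
  refine tendsto_const_nhds.congr' ?_
  filter_upwards [eventually_gt_atTop 0] with N hN
  have hN' : (N : ℝ) ≠ 0 := by exact_mod_cast hN.ne'
  rw [Set.univ_inter, ← Finset.coe_Iio, Set.ncard_coe_finset, Nat.card_Iio, div_self hN']

/-! ### Densities of the level sets of `s(n + t) - s(n)` -/

/-- The set of `n` with `s(n + t) - s(n) ≥ k`. -/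
def diffSet (k : ℤ) (t : ℕ) : Set ℕ := {n | k ≤ (binSum (n + t) : ℤ) - binSum n}

theorem cusickSet_eq_diffSet (t : ℕ) : cusickSet t = diffSet 0 t := by
  ext n
  simp [cusickSet, diffSet]

theorem two_mul_mem_diffSet_two_mul (k : ℤ) (t m : ℕ) :
    2 * m ∈ diffSet k (2 * t) ↔ m ∈ diffSet k t := by
  simp only [diffSet, Set.mem_ofPred_eq]
  rw [show 2 * m + 2 * t = 2 * (m + t) by ring, binSum_two_mul, binSum_two_mul]

theorem two_mul_add_one_mem_diffSet_two_mul (k : ℤ) (t m : ℕ) :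
    2 * m + 1 ∈ diffSet k (2 * t) ↔ m ∈ diffSet k t := by
  simp only [diffSet, Set.mem_ofPred_eq]
  rw [show 2 * m + 1 + 2 * t = 2 * (m + t) + 1 by ring, binSum_two_mul_add_one,
    binSum_two_mul_add_one]
  push_cast
  constructor <;> intro h <;> linarith

theorem two_mul_mem_diffSet_two_mul_add_one (k : ℤ) (t m : ℕ) :
    2 * m ∈ diffSet k (2 * t + 1) ↔ m ∈ diffSet (k - 1) t := by
  simp only [diffSet, Set.mem_ofPred_eq]
  rw [show 2 * m + (2 * t + 1) = 2 * (m + t) + 1 by ring, binSum_two_mul_add_one, binSum_two_mul]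
  push_cast
  constructor <;> intro h <;> linarith

theorem two_mul_add_one_mem_diffSet_two_mul_add_one (k : ℤ) (t m : ℕ) :
    2 * m + 1 ∈ diffSet k (2 * t + 1) ↔ m ∈ diffSet (k + 1) (t + 1) := by
  simp only [diffSet, Set.mem_ofPred_eq]
  rw [show 2 * m + 1 + (2 * t + 1) = 2 * (m + (t + 1)) by ring, binSum_two_mul_add_one,
    binSum_two_mul]
  push_cast
  constructor <;> intro h <;> linarith

theorem diffSet_zero_of_nonpos {k : ℤ} (hk : k ≤ 0) : diffSet k 0 = Set.univ := by
  ext n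
  simp [diffSet, hk]

theorem diffSet_zero_of_pos {k : ℤ} (hk : 0 < k) : diffSet k 0 = ∅ := by
  ext n
  simp [diffSet, hk]

theorem diffSet_one_of_two_le {k : ℤ} (hk : 2 ≤ k) : diffSet k 1 = ∅ := by
  ext n
  have := binSum_succ_le n
  simp only [diffSet, Set.mem_ofPred_eq, Set.mem_empty_iff_false, iff_false]
  omega

/-- For odd `n` the digit step leads from `t = 1` back to `t = 1`, with `k` raised by one. The
induction therefore runs on `k`, downwards from `2`, where the set is empty. -/
theorem hasDensity_diffSet_one (m : ℕ) :
    HasDensity (diffSet (2 - m) 1) (1 - (1 / 2) ^ m) := by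
  induction m with
  | zero =>
    rw [diffSet_one_of_two_le (by simp)]
    simpa using hasDensity_empty
  | succ m ih =>
    have h0 : HasDensity (diffSet (2 - (m + 1 : ℕ) - 1) 0) 1 := by
      rw [diffSet_zero_of_nonpos (by push_cast; linarith)]
      exact hasDensity_univ
    have h := h0.interleave ih (C := diffSet (2 - (m + 1 : ℕ)) 1)
      (fun n => two_mul_mem_diffSet_two_mul_add_one _ 0 n) (fun n => by
        rw [show (2 - m : ℤ) = 2 - (m + 1 : ℕ) + 1 by push_cast; ring]
        exact two_mul_add_one_mem_diffSet_two_mul_add_one _ 0 n)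
    convert h using 1
    rw [pow_succ]
    ring

theorem exists_hasDensity_diffSet (t : ℕ) : ∀ k : ℤ, ∃ d, HasDensity (diffSet k t) d := by
  induction t using Nat.strong_induction_on with
  | _ t ih =>
    intro k
    rcases Nat.even_or_odd' t with ⟨m, rfl | rfl⟩
    · rcases Nat.eq_zero_or_pos m with rfl | hm
      · rcases le_or_gt k 0 with hk | hk
        · exact ⟨1, by rw [mul_zero, diffSet_zero_of_nonpos hk]; exact hasDensity_univ⟩
        · exact ⟨0, by rw [mul_zero, diffSet_zero_of_pos hk]; exact hasDensity_empty⟩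
      · obtain ⟨d, hd⟩ := ih m (by omega) k
        exact ⟨_, hd.interleave hd (two_mul_mem_diffSet_two_mul k m)
          (two_mul_add_one_mem_diffSet_two_mul k m)⟩
    · rcases Nat.eq_zero_or_pos m with rfl | hm
      · rcases le_or_gt 2 k with hk | hk
        · exact ⟨0, by rw [diffSet_one_of_two_le hk]; exact hasDensity_empty⟩
        · obtain ⟨n, hn⟩ := Int.eq_ofNat_of_zero_le (show 0 ≤ 2 - k by omega)
          obtain rfl : k = 2 - n := by omega
          exact ⟨_, hasDensity_diffSet_one n⟩
      -- For `m > 0` both `m` and `m + 1` are smaller than `2 * m + 1`; only `t = 1` escapes the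
      -- descent.
      · obtain ⟨d, hd⟩ := ih m (by omega) (k - 1)
        obtain ⟨e, he⟩ := ih (m + 1) (by omega) (k + 1)
        exact ⟨_, hd.interleave he (two_mul_mem_diffSet_two_mul_add_one k m)
          (two_mul_add_one_mem_diffSet_two_mul_add_one k m)⟩

theorem hasDensity_diffSet (k : ℤ) (t : ℕ) : HasDensity (diffSet k t) (dens (diffSet k t)) := by
  obtain ⟨d, hd⟩ := exists_hasDensity_diffSet t k
  rwa [hd.dens_eq]

theorem dens_diffSet_two_mul (k : ℤ) (t : ℕ) :
    dens (diffSet k (2 * t)) = dens (diffSet k t) := by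
  have h := hasDensity_diffSet k t
  rw [(h.interleave h (two_mul_mem_diffSet_two_mul k t)
    (two_mul_add_one_mem_diffSet_two_mul k t)).dens_eq]
  ring

theorem dens_diffSet_two_mul_add_one (k : ℤ) (t : ℕ) :
    dens (diffSet k (2 * t + 1)) =
      (dens (diffSet (k - 1) t) + dens (diffSet (k + 1) (t + 1))) / 2 :=
  ((hasDensity_diffSet (k - 1) t).interleave (hasDensity_diffSet (k + 1) (t + 1))
    (two_mul_mem_diffSet_two_mul_add_one k t)
    (two_mul_add_one_mem_diffSet_two_mul_add_one k t)).dens_eq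

/-! ### The three-term recursion along `t_j` -/

/-- The density of `{n : s(n + t_j) - s(n) ≥ k}`. -/
noncomputable def tailDens (j : ℕ) (k : ℤ) : ℝ := dens (diffSet k (tSeq j))

theorem cusickDensity_tSeq (j : ℕ) : cusickDensity (tSeq j) = tailDens j 0 := by
  rw [cusickDensity, cusickSet_eq_diffSet, tailDens]

theorem tSeq_zero : tSeq 0 = 0 := rfl

theorem tSeq_one : tSeq 1 = 1 := rfl

theorem tSeq_succ (j : ℕ) : tSeq (j + 1) = 2 * (2 * tSeq j) + 1 := by
  have h1 := three_mul_tSeq_add_one j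
  have h2 := three_mul_tSeq_add_one (j + 1)
  rw [pow_succ] at h2
  omega

theorem tailDens_succ (j : ℕ) (k : ℤ) :
    tailDens (j + 1) k = tailDens j (k - 1) / 2 + tailDens j k / 4 +
      dens (diffSet (k + 2) (tSeq j + 1)) / 4 := by
  unfold tailDens
  rw [tSeq_succ, dens_diffSet_two_mul_add_one, dens_diffSet_two_mul, dens_diffSet_two_mul_add_one,
    show k + 1 - 1 = k by ring, show k + 1 + 1 = k + 2 by ring]
  ring

theorem dens_diffSet_tSeq_succ_add_one (j : ℕ) (k : ℤ) :
    dens (diffSet k (tSeq (j + 1) + 1)) =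
      tailDens j (k - 1) / 2 + dens (diffSet (k + 1) (tSeq j + 1)) / 2 := by
  unfold tailDens
  rw [tSeq_succ, show 2 * (2 * tSeq j) + 1 + 1 = 2 * (2 * tSeq j + 1) by ring,
    dens_diffSet_two_mul, dens_diffSet_two_mul_add_one]
  ring

/-- The shifts `k + 2` and `k + 1` are chosen so that the same density for `t_j + 1`, at level `k +
3`, occurs in `h2` and `h3` and can be eliminated. -/
theorem tailDens_add_two (j : ℕ) (k : ℤ) :
    tailDens (j + 2) k = tailDens (j + 1) k / 4 +
      (tailDens (j + 1) (k + 1) + tailDens (j + 1) (k - 1)) / 2 - tailDens j k / 4 := by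
  have h1 := tailDens_succ (j + 1) k
  have h2 := dens_diffSet_tSeq_succ_add_one j (k + 2)
  have h3 := tailDens_succ j (k + 1)
  rw [show k + 2 - 1 = k + 1 by ring, show k + 2 + 1 = k + 3 by ring] at h2
  rw [show k + 1 - 1 = k by ring, show k + 1 + 2 = k + 3 by ring] at h3
  rw [show j + 2 = j + 1 + 1 from rfl]
  linarith

theorem tailDens_zero_of_nonpos {k : ℤ} (hk : k ≤ 0) : tailDens 0 k = 1 := by
  rw [tailDens, tSeq_zero, diffSet_zero_of_nonpos hk, hasDensity_univ.dens_eq]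

theorem tailDens_zero_of_pos {k : ℤ} (hk : 0 < k) : tailDens 0 k = 0 := by
  rw [tailDens, tSeq_zero, diffSet_zero_of_pos hk, hasDensity_empty.dens_eq]

theorem tailDens_one_of_two_le {k : ℤ} (hk : 2 ≤ k) : tailDens 1 k = 0 := by
  rw [tailDens, tSeq_one, diffSet_one_of_two_le hk, hasDensity_empty.dens_eq]

theorem tailDens_one_two_sub (m : ℕ) : tailDens 1 (2 - m) = 1 - (1 / 2) ^ m := by
  rw [tailDens, tSeq_one, (hasDensity_diffSet_one m).dens_eq]

theorem tailDens_one_neg (m : ℕ) : tailDens 1 (-m) = 1 - (1 / 2) ^ (m + 2) := by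
  rw [← tailDens_one_two_sub]
  congr 1
  push_cast
  ring

theorem tailDens_one_one : tailDens 1 1 = 1 / 2 := by
  have := tailDens_one_two_sub 1
  norm_num at this ⊢
  exact this

theorem reverse_digits_tSeq_succ (j : ℕ) :
    (Nat.digits 2 (tSeq (j + 1))).reverse = (List.replicate j [1, 0]).flatten ++ [1] := by
  induction j with
  | zero => simp [tSeq_one]
  | succ j ih =>
    have hpos : 0 < tSeq (j + 1) := by rw [tSeq_succ]; omega
    rw [tSeq_succ (j + 1), Nat.digits_def' (by norm_num) (by omega),
      show (2 * (2 * tSeq (j + 1)) + 1) % 2 = 1 by omega,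
      show (2 * (2 * tSeq (j + 1)) + 1) / 2 = 2 * tSeq (j + 1) by omega,
      Nat.digits_def' (by norm_num) (by omega),
      show (2 * tSeq (j + 1)) % 2 = 0 by omega,
      show (2 * tSeq (j + 1)) / 2 = tSeq (j + 1) by omega,
      List.reverse_cons, List.reverse_cons, ih, List.replicate_succ']
    simp

/-! ### Positivity through window sums -/

/-- The sum of `tailDens j - 1/2` over `-k, -k + 2, …, k`. -/
noncomputable def symmSum (j k : ℕ) : ℝ :=
  ∑ i ∈ Finset.range (k + 1), (tailDens j (k - 2 * i) - 1 / 2)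

theorem symmSum_zero_right (j : ℕ) : symmSum j 0 = tailDens j 0 - 1 / 2 := by
  simp [symmSum]

theorem symmSum_one_right (j : ℕ) :
    symmSum j 1 = tailDens j 1 + tailDens j (-1) - 1 := by
  simp [symmSum, Finset.sum_range_succ]

theorem symmSum_add_two_right (j k : ℕ) :
    symmSum j (k + 2) =
      symmSum j k + (tailDens j (k + 2 : ℕ) + tailDens j (-(k + 2 : ℕ)) - 1) := by
  unfold symmSum
  rw [Finset.sum_range_succ, Finset.sum_range_succ', Finset.sum_congr rfl (g := fun i : ℕ =>
    tailDens j (k - 2 * i) - 1 / 2) (fun i _ => by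
      congr 2
      push_cast
      ring)]
  rw [show (((k + 2 : ℕ) : ℤ) - 2 * ((0 : ℕ) : ℤ)) = (k + 2 : ℕ) by push_cast; ring,
    show (((k + 2 : ℕ) : ℤ) - 2 * ((k + 2 : ℕ) : ℤ)) = -(k + 2 : ℕ) by push_cast; ring]
  ring

/-- The general recursion with an empty window, of sum zero, as the lower neighbour. -/
theorem symmSum_add_two_zero (j : ℕ) :
    symmSum (j + 2) 0 = symmSum (j + 1) 0 / 4 + symmSum (j + 1) 1 / 2 - symmSum j 0 / 4 := by
  have h := tailDens_add_two j 0
  rw [symmSum_zero_right, symmSum_zero_right, symmSum_zero_right, symmSum_one_right, h]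
  norm_num
  ring

/-- Shifting the window `-(k+1), …, k+1` up and down by one covers, with multiplicity, the windows
of `k + 2` and of `k`: the point `-(k+2)` only changes sides. -/
theorem symmSum_add_two_succ (j k : ℕ) :
    symmSum (j + 2) (k + 1) = symmSum (j + 1) (k + 1) / 4 +
      (symmSum (j + 1) (k + 2) + symmSum (j + 1) k) / 2 - symmSum j (k + 1) / 4 := by
  have h1 : symmSum (j + 1) (k + 2) = ∑ i ∈ Finset.range (k + 2),
      (tailDens (j + 1) ((k + 1 : ℕ) - 2 * i + 1) - 1 / 2) +
      (tailDens (j + 1) (-(k + 2 : ℕ)) - 1 / 2) := by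
    unfold symmSum
    rw [Finset.sum_range_succ]
    congr 1
    · refine Finset.sum_congr rfl fun i _ => ?_
      congr 2
      push_cast
      ring
    · congr 2
      push_cast
      ring
  have h2 : ∑ i ∈ Finset.range (k + 2), (tailDens (j + 1) ((k + 1 : ℕ) - 2 * i - 1) - 1 / 2) =
      symmSum (j + 1) k + (tailDens (j + 1) (-(k + 2 : ℕ)) - 1 / 2) := by
    unfold symmSum
    rw [Finset.sum_range_succ]
    congr 1
    · refine Finset.sum_congr rfl fun i _ => ?_
      congr 2
      push_cast
      ring
    · congr 2
      push_cast
      ring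
  have h3 : symmSum (j + 1) (k + 2) + symmSum (j + 1) k = ∑ i ∈ Finset.range (k + 2),
      ((tailDens (j + 1) ((k + 1 : ℕ) - 2 * i + 1) - 1 / 2) +
        (tailDens (j + 1) ((k + 1 : ℕ) - 2 * i - 1) - 1 / 2)) := by
    rw [Finset.sum_add_distrib, h2, h1]
    ring
  rw [h3]
  unfold symmSum
  rw [Finset.sum_div, Finset.sum_div, Finset.sum_div, ← Finset.sum_add_distrib,
    ← Finset.sum_sub_distrib]
  refine Finset.sum_congr rfl fun i _ => ?_
  rw [tailDens_add_two]
  ring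

theorem symmSum_zero_even (m : ℕ) : symmSum 0 (2 * m) = 1 / 2 := by
  induction m with
  | zero => rw [symmSum_zero_right, tailDens_zero_of_nonpos le_rfl]; norm_num
  | succ m ih =>
    rw [show 2 * (m + 1) = 2 * m + 2 by ring, symmSum_add_two_right, ih,
      tailDens_zero_of_pos (by positivity), tailDens_zero_of_nonpos (by push_cast; linarith)]
    norm_num

theorem symmSum_zero_odd (m : ℕ) : symmSum 0 (2 * m + 1) = 0 := by
  induction m with
  | zero =>
    rw [symmSum_one_right, tailDens_zero_of_pos (by norm_num),
      tailDens_zero_of_nonpos (by norm_num)]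
    norm_num
  | succ m ih =>
    rw [show 2 * (m + 1) + 1 = 2 * m + 1 + 2 by ring, symmSum_add_two_right, ih,
      tailDens_zero_of_pos (by positivity), tailDens_zero_of_nonpos (by push_cast; linarith)]
    norm_num

theorem symmSum_one_add_two (k : ℕ) :
    symmSum 1 (k + 2) = symmSum 1 k - (1 / 2) ^ (k + 4) := by
  rw [symmSum_add_two_right, tailDens_one_of_two_le (by push_cast; linarith), tailDens_one_neg]
  ring

theorem symmSum_one_even (m : ℕ) : symmSum 1 (2 * m) = 1 / 6 + (1 / 12) * (1 / 4) ^ m := by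
  induction m with
  | zero =>
    have := tailDens_one_neg 0
    norm_num at this
    rw [symmSum_zero_right, this]
    norm_num
  | succ m ih =>
    rw [show 2 * (m + 1) = 2 * m + 2 by ring, symmSum_one_add_two, ih, pow_add, pow_mul]
    norm_num [pow_succ]
    ring

theorem symmSum_one_odd (m : ℕ) : symmSum 1 (2 * m + 1) = 1 / 3 + (1 / 24) * (1 / 4) ^ m := by
  induction m with
  | zero =>
    have := tailDens_one_neg 1
    norm_num at this
    rw [symmSum_one_right, this, tailDens_one_one]
    norm_num
  | succ m ih =>
    rw [show 2 * (m + 1) + 1 = 2 * m + 1 + 2 by ring, symmSum_one_add_two, ih,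
      show 2 * m + 1 + 4 = 2 * m + 5 by ring, pow_add, pow_mul]
    norm_num [pow_succ]
    ring

theorem symmSum_one_nonneg (k : ℕ) : 0 ≤ symmSum 1 k := by
  rcases Nat.even_or_odd' k with ⟨m, rfl | rfl⟩
  · rw [symmSum_one_even]; positivity
  · rw [symmSum_one_odd]; positivity

theorem half_symmSum_zero_le (k : ℕ) : symmSum 0 k / 2 ≤ symmSum 1 (k + 1) := by
  rcases Nat.even_or_odd' k with ⟨m, rfl | rfl⟩
  · rw [symmSum_zero_even, symmSum_one_odd]
    have : (0 : ℝ) ≤ (1 / 4) ^ m := by positivity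
    linarith
  · rw [symmSum_zero_odd, zero_div]
    exact symmSum_one_nonneg _

/-- The second inequality at `k + 1` makes `symmSum (j + 1) (k + 2) / 2` outweigh the negative term
`symmSum j (k + 1) / 4`. What remains is nonnegative and contains `symmSum (j + 1) k / 2`, so both
statements propagate. Window sums are needed because the even part itself is negative at `j = 1`,
`|k| ≥ 2`. -/
theorem symmSum_invariant (j : ℕ) :
    (∀ k, 0 ≤ symmSum (j + 1) k) ∧ (∀ k, symmSum j k / 2 ≤ symmSum (j + 1) (k + 1)) := by
  induction j with
  | zero => exact ⟨symmSum_one_nonneg, half_symmSum_zero_le⟩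
  | succ j ih =>
    obtain ⟨hpos, hle⟩ := ih
    have hstep : ∀ k, symmSum (j + 1) k / 2 ≤ symmSum (j + 2) (k + 1) := fun k => by
      have h1 := symmSum_add_two_succ j k
      have h2 := hle (k + 1)
      have h3 := hpos (k + 1)
      linarith
    refine ⟨fun k => ?_, hstep⟩
    rcases k with _ | k
    · have h1 := symmSum_add_two_zero j
      have h2 := hle 0
      have h3 := hpos 0
      rw [zero_add] at h2
      linarith
    · have h1 := hstep k
      have h2 := hpos k
      linarith

theorem symmSum_succ_zero_pos (j : ℕ) : 0 < symmSum (j + 1) 0 := by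
  induction j with
  | zero =>
    have := symmSum_one_even 0
    norm_num at this ⊢
    rw [this]
    norm_num
  | succ j ih =>
    have h1 := symmSum_add_two_zero j
    have h2 := (symmSum_invariant j).2 0
    rw [zero_add] at h2
    linarith

theorem half_lt_cusickDensity_tSeq_succ (j : ℕ) : 1 / 2 < cusickDensity (tSeq (j + 1)) := by
  have := symmSum_succ_zero_pos j
  rw [symmSum_zero_right] at this
  rw [cusickDensity_tSeq]
  linarith

/-! ### Fourier transform of the even part -/

/-- The Fourier transform of the even part of `tailDens 1 - 1/2`. -/
noncomputable def initSymbol (θ : ℝ) : ℝ :=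
  1 / 2 + Real.cos θ / 2 - (2 - Real.cos θ) / (5 - 4 * Real.cos θ) / 2

/-- The Fourier transform of the even part of `tailDens j - 1/2`. -/
noncomputable def symbol : ℕ → ℝ → ℝ
  | 0, _ => 1 / 2
  | 1, θ => initSymbol θ
  | j + 2, θ => (1 / 4 + Real.cos θ) * symbol (j + 1) θ - symbol j θ / 4

theorem five_sub_four_mul_cos_pos (θ : ℝ) : 0 < 5 - 4 * Real.cos θ := by
  linarith [Real.cos_le_one θ]

theorem continuous_poisson :
    Continuous fun θ : ℝ => (2 - Real.cos θ) / (5 - 4 * Real.cos θ) := by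
  refine Continuous.div (by fun_prop) (by fun_prop) fun θ => (five_sub_four_mul_cos_pos θ).ne'

theorem continuous_symbol : ∀ j, Continuous (symbol j)
  | 0 => by simpa only [symbol] using continuous_const
  | 1 => by
    change Continuous initSymbol
    unfold initSymbol
    have := continuous_poisson
    fun_prop
  | j + 2 => by
    have h1 := continuous_symbol (j + 1)
    have h2 := continuous_symbol j
    change Continuous fun θ => (1 / 4 + Real.cos θ) * symbol (j + 1) θ - symbol j θ / 4
    fun_prop

theorem integral_cos_int_mul (n : ℤ) :
    ∫ θ in -Real.pi..Real.pi, Real.cos (n * θ) = if n = 0 then 2 * Real.pi else 0 := by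
  split_ifs with h
  · subst h
    simp
    ring
  · have hn : (n : ℝ) ≠ 0 := by exact_mod_cast h
    rw [intervalIntegral.integral_comp_mul_left _ hn]
    simp [Real.sin_int_mul_pi]

/-- Real part of a geometric series in `e^{iθ} / 2`. It produces the values `-(1/2)^(|k|+3)` of
`evenTail 1` for `|k| ≥ 2`; the terms `1/2 + cos θ / 2` of `initSymbol` correct `k = 0, ±1`. -/
theorem hasSum_half_pow_mul_cos (θ : ℝ) :
    HasSum (fun l : ℕ => (1 / 2 : ℝ) ^ (l + 1) * Real.cos (l * θ))
      ((2 - Real.cos θ) / (5 - 4 * Real.cos θ)) := by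
  have hnorm : ‖(1 / 2 : ℂ) * Complex.exp (θ * Complex.I)‖ < 1 := by
    rw [norm_mul, Complex.norm_exp_ofReal_mul_I]
    norm_num
  have h := (Complex.hasSum_re (hasSum_geometric_of_norm_lt_one hnorm)).mul_left (1 / 2)
  have hval : (2 - Real.cos θ) / (5 - 4 * Real.cos θ) =
      1 / 2 * ((1 - 1 / 2 * Complex.exp (θ * Complex.I))⁻¹).re := by
    have hs := Real.sin_sq_add_cos_sq θ
    have hpos := five_sub_four_mul_cos_pos θ
    have hz : 1 - 1 / 2 * Complex.exp (θ * Complex.I) =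
        ⟨1 - Real.cos θ / 2, -(Real.sin θ / 2)⟩ := by
      apply Complex.ext
      · rw [show (1 / 2 : ℂ) = ((1 / 2 : ℝ) : ℂ) by norm_num, Complex.sub_re,
          Complex.re_ofReal_mul, Complex.exp_ofReal_mul_I_re, Complex.one_re]
        ring
      · rw [show (1 / 2 : ℂ) = ((1 / 2 : ℝ) : ℂ) by norm_num, Complex.sub_im,
          Complex.im_ofReal_mul, Complex.exp_ofReal_mul_I_im, Complex.one_im]
        ring
    rw [hz, Complex.inv_re, Complex.normSq_mk,
      show (1 - Real.cos θ / 2) * (1 - Real.cos θ / 2) +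
        -(Real.sin θ / 2) * -(Real.sin θ / 2) = (5 - 4 * Real.cos θ) / 4 by
      linear_combination hs / 4]
    field_simp
    ring
  rw [hval]
  refine (congrArg (HasSum · _) (funext fun l => ?_)).mpr h
  rw [mul_pow, ← Complex.exp_nat_mul, show (l : ℂ) * (θ * Complex.I) =
    ((l * θ : ℝ) : ℂ) * Complex.I by push_cast; ring,
    show (1 / 2 : ℂ) ^ l = (((1 / 2) ^ l : ℝ) : ℂ) by push_cast; ring, Complex.re_ofReal_mul,
    Complex.exp_ofReal_mul_I_re, pow_succ]
  ring

theorem integral_cos_mul_cos (l k : ℕ) :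
    ∫ θ in -Real.pi..Real.pi, Real.cos (l * θ) * Real.cos (k * θ) =
      if l = k then (if k = 0 then 2 * Real.pi else Real.pi) else 0 := by
  have h : ∀ θ : ℝ, Real.cos (l * θ) * Real.cos (k * θ) =
      (Real.cos (((l + k : ℤ) : ℝ) * θ) + Real.cos (((l - k : ℤ) : ℝ) * θ)) / 2 := fun θ => by
    push_cast
    rw [add_mul, sub_mul, Real.cos_add, Real.cos_sub]
    ring
  simp_rw [h]
  rw [intervalIntegral.integral_div, intervalIntegral.integral_add
    (Continuous.intervalIntegrable (by fun_prop) _ _)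
    (Continuous.intervalIntegrable (by fun_prop) _ _), integral_cos_int_mul, integral_cos_int_mul]
  split_ifs <;> first | omega | ring

theorem integral_poisson_mul_cos (k : ℕ) :
    ∫ θ in -Real.pi..Real.pi, (2 - Real.cos θ) / (5 - 4 * Real.cos θ) * Real.cos (k * θ) =
      (1 / 2) ^ (k + 1) * (if k = 0 then 2 * Real.pi else Real.pi) := by
  have h := intervalIntegral.hasSum_integral_of_dominated_convergence
    (μ := MeasureTheory.volume) (a := -Real.pi) (b := Real.pi)
    (F := fun (l : ℕ) θ => (1 / 2 : ℝ) ^ (l + 1) * Real.cos (l * θ) * Real.cos (k * θ))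
    (f := fun θ => (2 - Real.cos θ) / (5 - 4 * Real.cos θ) * Real.cos (k * θ))
    (fun l _ => (1 / 2 : ℝ) ^ (l + 1))
    (fun l => (Continuous.aestronglyMeasurable (by fun_prop)))
    (fun l => Eventually.of_forall fun θ _ => by
      rw [norm_mul, norm_mul, Real.norm_eq_abs, Real.norm_eq_abs, Real.norm_eq_abs,
        abs_of_nonneg (by positivity : (0 : ℝ) ≤ (1 / 2) ^ (l + 1)), mul_assoc]
      exact mul_le_of_le_one_right (by positivity)
        (mul_le_one₀ (Real.abs_cos_le_one _) (abs_nonneg _) (Real.abs_cos_le_one _)))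
    (Eventually.of_forall fun θ _ =>
      (summable_nat_add_iff 1).2 (summable_geometric_of_lt_one (by norm_num) (by norm_num)))
    (by simp)
    (Eventually.of_forall fun θ _ => (hasSum_half_pow_mul_cos θ).mul_right _)
  refine h.unique ?_
  simp_rw [mul_assoc, intervalIntegral.integral_const_mul, integral_cos_mul_cos]
  have := hasSum_ite_eq k ((1 / 2 : ℝ) ^ (k + 1) * (if k = 0 then 2 * Real.pi else Real.pi))
  refine (congrArg (HasSum · _) (funext fun l => ?_)).mpr this
  split_ifs <;> simp_all

/-- The even part of `tailDens j - 1/2`. -/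
noncomputable def evenTail (j : ℕ) (k : ℤ) : ℝ := (tailDens j k + tailDens j (-k) - 1) / 2

theorem evenTail_neg (j : ℕ) (k : ℤ) : evenTail j (-k) = evenTail j k := by
  rw [evenTail, evenTail, neg_neg, add_comm (tailDens j (-k))]

theorem evenTail_add_two (j : ℕ) (k : ℤ) :
    evenTail (j + 2) k = evenTail (j + 1) k / 4 +
      (evenTail (j + 1) (k + 1) + evenTail (j + 1) (k - 1)) / 2 - evenTail j k / 4 := by
  unfold evenTail
  rw [tailDens_add_two, tailDens_add_two, show -(k + 1) = -k - 1 by ring,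
    show -(k - 1) = -k + 1 by ring]
  ring

theorem evenTail_zero (k : ℤ) : evenTail 0 k = if k = 0 then 1 / 2 else 0 := by
  unfold evenTail
  rcases lt_trichotomy k 0 with h | h | h
  · rw [tailDens_zero_of_nonpos h.le, tailDens_zero_of_pos (by omega), if_neg h.ne]
    norm_num
  · subst h
    rw [neg_zero, tailDens_zero_of_nonpos le_rfl]
    norm_num
  · rw [tailDens_zero_of_pos h, tailDens_zero_of_nonpos (by omega), if_neg h.ne']
    norm_num

theorem integral_initSymbol_mul_cos_nat (k : ℕ) :
    ∫ θ in -Real.pi..Real.pi, initSymbol θ * Real.cos (k * θ) =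
      2 * Real.pi * evenTail 1 k := by
  have h : ∀ θ : ℝ, initSymbol θ * Real.cos (k * θ) =
      Real.cos ((0 : ℕ) * θ) * Real.cos (k * θ) / 2 +
      Real.cos ((1 : ℕ) * θ) * Real.cos (k * θ) / 2 -
      (2 - Real.cos θ) / (5 - 4 * Real.cos θ) * Real.cos (k * θ) / 2 := fun θ => by
    simp [initSymbol]
    ring
  simp_rw [h]
  have hP := continuous_poisson
  rw [intervalIntegral.integral_sub
    (Continuous.intervalIntegrable (by fun_prop) _ _)
    (Continuous.intervalIntegrable (by fun_prop) _ _),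
    intervalIntegral.integral_add
    (Continuous.intervalIntegrable (by fun_prop) _ _)
    (Continuous.intervalIntegrable (by fun_prop) _ _),
    intervalIntegral.integral_div, intervalIntegral.integral_div, intervalIntegral.integral_div,
    integral_cos_mul_cos, integral_cos_mul_cos, integral_poisson_mul_cos, evenTail,
    tailDens_one_neg]
  rcases k with _ | _ | k
  · have := tailDens_one_neg 0
    norm_num at this
    norm_num [this]
    ring
  · norm_num [tailDens_one_one]
    ring
  · rw [tailDens_one_of_two_le (by push_cast; linarith), if_neg (by omega), if_neg (by omega),
      if_neg (by omega)]
    ring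

theorem integral_initSymbol_mul_cos (k : ℤ) :
    ∫ θ in -Real.pi..Real.pi, initSymbol θ * Real.cos (k * θ) =
      2 * Real.pi * evenTail 1 k := by
  obtain ⟨n, rfl | rfl⟩ := k.eq_nat_or_neg
  · simpa using integral_initSymbol_mul_cos_nat n
  · rw [evenTail_neg]
    simpa using integral_initSymbol_mul_cos_nat n

/-- Multiplication by `cos θ` averages neighbouring Fourier coefficients, which turns the recursion
of `symbol` into `evenTail_add_two`. -/
theorem integral_symbol_mul_cos : ∀ (j : ℕ) (k : ℤ),
    ∫ θ in -Real.pi..Real.pi, symbol j θ * Real.cos (k * θ) = 2 * Real.pi * evenTail j k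
  | 0, k => by
    simp only [symbol]
    rw [intervalIntegral.integral_const_mul, integral_cos_int_mul, evenTail_zero]
    split_ifs <;> ring
  | 1, k => integral_initSymbol_mul_cos k
  | j + 2, k => by
    have h : ∀ θ : ℝ, symbol (j + 2) θ * Real.cos (k * θ) =
        symbol (j + 1) θ * Real.cos (k * θ) / 4 +
        (symbol (j + 1) θ * Real.cos (((k + 1 : ℤ) : ℝ) * θ) +
          symbol (j + 1) θ * Real.cos (((k - 1 : ℤ) : ℝ) * θ)) / 2 -
        symbol j θ * Real.cos (k * θ) / 4 := fun θ => by
      push_cast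
      rw [add_mul, sub_mul, one_mul, Real.cos_add, Real.cos_sub, symbol]
      ring
    have h1 := continuous_symbol (j + 1)
    have h2 := continuous_symbol j
    simp_rw [h]
    rw [intervalIntegral.integral_sub
      (Continuous.intervalIntegrable (by fun_prop) _ _)
      (Continuous.intervalIntegrable (by fun_prop) _ _),
      intervalIntegral.integral_add
      (Continuous.intervalIntegrable (by fun_prop) _ _)
      (Continuous.intervalIntegrable (by fun_prop) _ _),
      intervalIntegral.integral_div, intervalIntegral.integral_div, intervalIntegral.integral_div,
      intervalIntegral.integral_add
      (Continuous.intervalIntegrable (by fun_prop) _ _)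
      (Continuous.intervalIntegrable (by fun_prop) _ _),
      integral_symbol_mul_cos (j + 1), integral_symbol_mul_cos (j + 1),
      integral_symbol_mul_cos (j + 1), integral_symbol_mul_cos j, evenTail_add_two]
    ring

theorem integral_symbol (j : ℕ) :
    ∫ θ in -Real.pi..Real.pi, symbol j θ = 2 * Real.pi * (cusickDensity (tSeq j) - 1 / 2) := by
  have h := integral_symbol_mul_cos j 0
  simp only [Int.cast_zero, zero_mul, Real.cos_zero, mul_one] at h
  rw [h, evenTail, cusickDensity_tSeq, neg_zero]
  ring

/-! ### Geometric decay away from `θ = 0` -/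

/-- The differences `x (j + 1) - a * x j` are geometric with ratio `b`. Nothing is divided by `a -
b`, so a double root is allowed, at the price of the factor `j`. -/
theorem norm_le_of_two_step_recursion {x : ℕ → ℂ} {a b : ℂ} {r : ℝ} (ha : ‖a‖ ≤ r) (hb : ‖b‖ ≤ r)
    (hx : ∀ j, x (j + 2) = (a + b) * x (j + 1) - a * b * x j) (j : ℕ) :
    r * ‖x j‖ ≤ r ^ j * (r * ‖x 0‖ + j * ‖x 1 - a * x 0‖) := by
  have hr : 0 ≤ r := (norm_nonneg a).trans ha
  have hy : ∀ j, ‖x (j + 1) - a * x j‖ ≤ r ^ j * ‖x 1 - a * x 0‖ := fun j => by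
    induction j with
    | zero => simp
    | succ j ih =>
      rw [hx j, show (a + b) * x (j + 1) - a * b * x j - a * x (j + 1) =
        b * (x (j + 1) - a * x j) by ring, norm_mul, pow_succ', mul_assoc]
      exact mul_le_mul hb ih (norm_nonneg _) hr
  induction j with
  | zero => simp
  | succ j ih =>
    have h1 : ‖x (j + 1)‖ ≤ ‖x (j + 1) - a * x j‖ + r * ‖x j‖ := by
      calc ‖x (j + 1)‖ = ‖(x (j + 1) - a * x j) + a * x j‖ := by ring_nf
        _ ≤ ‖x (j + 1) - a * x j‖ + ‖a * x j‖ := norm_add_le _ _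
        _ ≤ _ := by rw [norm_mul]; gcongr
    calc r * ‖x (j + 1)‖ ≤ r * (r ^ j * ‖x 1 - a * x 0‖ +
          r ^ j * (r * ‖x 0‖ + j * ‖x 1 - a * x 0‖)) := by
          gcongr
          exact h1.trans (add_le_add (hy j) ih)
      _ = _ := by push_cast; ring

/-- For `|τ| ≤ 1` the roots are conjugate of modulus `1/2`; beyond that they are real. The bound
`23/20` is `1/4 + 9/10`, matching `cos θ ≤ 9/10`. -/
theorem exists_roots_of_le {τ : ℝ} (h1 : -1 ≤ τ) (h2 : τ ≤ 23 / 20) :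
    ∃ a b : ℂ, a + b = τ ∧ a * b = 1 / 4 ∧ ‖a‖ ≤ 9 / 10 ∧ ‖b‖ ≤ 9 / 10 := by
  rcases le_or_gt τ 1 with h | h
  · have hs : Real.sqrt (1 - τ ^ 2) ^ 2 = 1 - τ ^ 2 := Real.sq_sqrt (by nlinarith)
    set s := Real.sqrt (1 - τ ^ 2)
    refine ⟨⟨τ / 2, s / 2⟩, ⟨τ / 2, -s / 2⟩, ?_, ?_, ?_, ?_⟩
    · apply Complex.ext
      · simp
      · simp
        ring
    · apply Complex.ext
      · simp
        norm_num
        linarith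
      · simp
        ring
    · refine abs_le_of_sq_le_sq' ?_ (by norm_num) |>.2
      rw [← Complex.normSq_eq_norm_sq, Complex.normSq_mk]
      nlinarith
    · refine abs_le_of_sq_le_sq' ?_ (by norm_num) |>.2
      rw [← Complex.normSq_eq_norm_sq, Complex.normSq_mk]
      nlinarith
  · have hs : Real.sqrt (τ ^ 2 - 1) ^ 2 = τ ^ 2 - 1 := Real.sq_sqrt (by nlinarith)
    have hs0 : 0 ≤ Real.sqrt (τ ^ 2 - 1) := Real.sqrt_nonneg _
    set s := Real.sqrt (τ ^ 2 - 1)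
    have hs1 : s ≤ 9 / 5 - τ := abs_le_of_sq_le_sq' (by nlinarith) (by linarith) |>.2
    refine ⟨((τ + s) / 2 : ℝ), ((τ - s) / 2 : ℝ), ?_, ?_, ?_, ?_⟩
    · push_cast
      ring
    · rw [← Complex.ofReal_mul, show (τ + s) / 2 * ((τ - s) / 2) = 1 / 4 by nlinarith]
      norm_num
    · rw [Complex.norm_real, Real.norm_eq_abs, abs_le]
      constructor <;> linarith
    · rw [Complex.norm_real, Real.norm_eq_abs, abs_le]
      constructor <;> linarith

theorem abs_initSymbol_le_one (θ : ℝ) : |initSymbol θ| ≤ 1 := by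
  have hpos := five_sub_four_mul_cos_pos θ
  have h1 := Real.cos_le_one θ
  have h2 := Real.neg_one_le_cos θ
  have h3 : (2 - Real.cos θ) / (5 - 4 * Real.cos θ) ≤ 1 := by
    rw [div_le_one hpos]
    linarith
  have h4 : 0 ≤ (2 - Real.cos θ) / (5 - 4 * Real.cos θ) := div_nonneg (by linarith) hpos.le
  rw [initSymbol, abs_le]
  constructor <;> linarith

theorem abs_symbol_le_of_cos_le {θ : ℝ} (h : Real.cos θ ≤ 9 / 10) (j : ℕ) :
    |symbol j θ| ≤ (9 / 10) ^ j * (1 / 2 + 2 * j) := by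
  have hc := Real.neg_one_le_cos θ
  obtain ⟨a, b, hab, hmul, ha, hb⟩ := exists_roots_of_le (τ := 1 / 4 + Real.cos θ)
    (by linarith) (by linarith)
  have hrec := norm_le_of_two_step_recursion (x := fun j => (symbol j θ : ℂ)) ha hb (fun j => by
    rw [hab, hmul, symbol]
    push_cast
    ring) j
  -- A crude bound; dividing it by `9/10` gives the coefficient `2` of `j`.
  have hinit : ‖((symbol 1 θ : ℝ) : ℂ) - a * ((symbol 0 θ : ℝ) : ℂ)‖ ≤ 9 / 5 := by
    refine (norm_sub_le _ _).trans ?_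
    have h1 : ‖((symbol 1 θ : ℝ) : ℂ)‖ ≤ 1 := by
      rw [Complex.norm_real]
      exact abs_initSymbol_le_one θ
    have h0 : ‖((symbol 0 θ : ℝ) : ℂ)‖ = 1 / 2 := by
      rw [Complex.norm_real]
      norm_num [symbol]
    rw [norm_mul, h0]
    linarith
  simp only [Complex.norm_real, Real.norm_eq_abs] at hrec
  have h0 : |symbol 0 θ| = 1 / 2 := by norm_num [symbol]
  rw [h0] at hrec
  have hpow : (0 : ℝ) ≤ (9 / 10) ^ j := by positivity
  have hstep : (9 / 10 : ℝ) ^ j * (9 / 10 * (1 / 2) +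
      j * ‖((symbol 1 θ : ℝ) : ℂ) - a * ((symbol 0 θ : ℝ) : ℂ)‖) ≤
      (9 / 10) ^ j * (9 / 10 * (1 / 2) + j * (9 / 5)) := by gcongr
  have := hrec.trans hstep
  nlinarith

/-! ### Gaussian approximation of the symbol -/

/-- The leading term `a ^ j / 2` is split off because the remaining coefficient is `O(θ²)`: at `θ =
0` both `initSymbol` and `a / 2` equal `1/2`. -/
theorem symbol_eq_of_roots {θ a b : ℝ} (hab : a + b = 1 / 4 + Real.cos θ) (hmul : a * b = 1 / 4)
    (hne : a - b ≠ 0) : ∀ j, symbol j θ =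
      1 / 2 * a ^ j + (initSymbol θ - a / 2) / (a - b) * a ^ j -
        (initSymbol θ - a / 2) / (a - b) * b ^ j
  | 0 => by simp [symbol]
  | 1 => by
    rw [symbol]
    field_simp
    ring
  | j + 2 => by
    rw [symbol, symbol_eq_of_roots hab hmul hne (j + 1), symbol_eq_of_roots hab hmul hne j, ← hab,
      show ∀ y : ℝ, y / 4 = a * b * y from fun y => by rw [hmul]; ring]
    ring

theorem abs_initSymbol_sub_half_le (θ : ℝ) : |initSymbol θ - 1 / 2| ≤ 1 - Real.cos θ := by
  have hpos := five_sub_four_mul_cos_pos θ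
  have h1 := Real.cos_le_one θ
  have h : initSymbol θ - 1 / 2 = -(1 - Real.cos θ) / 2 +
      3 / 2 * ((1 - Real.cos θ) / (5 - 4 * Real.cos θ)) := by
    have hsum : (2 - Real.cos θ) / (5 - 4 * Real.cos θ) +
        3 * ((1 - Real.cos θ) / (5 - 4 * Real.cos θ)) = 1 := by
      rw [← mul_div_assoc, ← add_div, div_eq_one_iff_eq hpos.ne']
      ring
    rw [initSymbol]
    linarith
  have h3 : (1 - Real.cos θ) / (5 - 4 * Real.cos θ) ≤ 1 - Real.cos θ :=
    div_le_self (by linarith) (by linarith)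
  have h4 : 0 ≤ (1 - Real.cos θ) / (5 - 4 * Real.cos θ) := div_nonneg (by linarith) hpos.le
  rw [h, abs_le]
  constructor <;> linarith

theorem exists_real_roots {κ : ℝ} (h0 : 0 ≤ κ) (h1 : κ ≤ 1 / 8) :
    ∃ a b : ℝ, a + b = 5 / 4 - κ ∧ a * b = 1 / 4 ∧ 4 / 5 ≤ a ∧ 0 ≤ b ∧ b ≤ 1 / 3 ∧
      a ≤ 1 - κ ∧ 1 - 2 * κ ≤ a ∧ |1 - a - 4 / 3 * κ| ≤ 8 / 3 * κ ^ 2 := by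
  have hs : Real.sqrt ((5 / 4 - κ) ^ 2 - 1) ^ 2 = (5 / 4 - κ) ^ 2 - 1 := Real.sq_sqrt (by nlinarith)
  have hs0 : 0 ≤ Real.sqrt ((5 / 4 - κ) ^ 2 - 1) := Real.sqrt_nonneg _
  set s := Real.sqrt ((5 / 4 - κ) ^ 2 - 1)
  have hs1 : 1 / 2 ≤ s := abs_le_of_sq_le_sq' (by nlinarith) hs0 |>.2
  have hs2 : s ≤ 3 / 4 := abs_le_of_sq_le_sq' (by nlinarith) (by norm_num) |>.2
  have ha : 4 / 5 ≤ (5 / 4 - κ + s) / 2 := by linarith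
  have hmul : (5 / 4 - κ + s) / 2 * ((5 / 4 - κ - s) / 2) = 1 / 4 := by nlinarith
  obtain ⟨a, hadef⟩ : ∃ a, a = (5 / 4 - κ + s) / 2 := ⟨_, rfl⟩
  obtain ⟨b, hbdef⟩ : ∃ b, b = (5 / 4 - κ - s) / 2 := ⟨_, rfl⟩
  rw [← hadef, ← hbdef] at hmul
  rw [← hadef] at ha
  have hsum : a + b = 5 / 4 - κ := by rw [hadef, hbdef]; ring
  have ha1 : a ≤ 1 := by linarith
  -- The characteristic equation in terms of `1 - a`; to first order it gives `1 - a ≈ 4κ/3`.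
  have heq : (1 - a) * (3 / 4 + κ - (1 - a)) = κ := by
    have : b = 5 / 4 - κ - a := by linarith
    rw [this] at hmul
    linarith
  have hlo : κ ≤ 1 - a := by nlinarith
  have hhi : 1 - a ≤ 2 * κ := by nlinarith
  refine ⟨a, b, hsum, hmul, ha, ?_, ?_, by linarith, by linarith, ?_⟩
  · nlinarith
  · nlinarith
  · have : 1 - a - 4 / 3 * κ = 4 / 3 * ((1 - a) * (1 - a - κ)) := by linarith
    rw [this, abs_of_nonneg (by nlinarith)]
    nlinarith

/-- The gap `2/5 - 1/3 = 1/15` pays for the polynomial: `exp (y / 15) ≥ y² / 450`. -/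
theorem sq_mul_exp_neg_le {y : ℝ} (hy : 0 ≤ y) :
    y ^ 2 * Real.exp (-(2 / 5 * y)) ≤ 450 * Real.exp (-(1 / 3 * y)) := by
  have h := Real.quadratic_le_exp_of_nonneg (x := y / 15) (by positivity)
  have hE : Real.exp (-(1 / 3 * y)) = Real.exp (y / 15) * Real.exp (-(2 / 5 * y)) := by
    rw [← Real.exp_add]
    ring_nf
  rw [hE, ← mul_assoc]
  gcongr
  nlinarith

theorem mul_exp_neg_le (y : ℝ) :
    y * Real.exp (-(2 / 5 * y)) ≤ 15 * Real.exp (-(1 / 3 * y)) := by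
  have h := Real.add_one_le_exp (y / 15)
  have hE : Real.exp (-(1 / 3 * y)) = Real.exp (y / 15) * Real.exp (-(2 / 5 * y)) := by
    rw [← Real.exp_add]
    ring_nf
  rw [hE, ← mul_assoc]
  gcongr
  linarith

/-- Replacing `a` by `g` costs `j q² = (j q)² / j` times an exponential, which yields the factor `1
/ j`. The lower bound `3/4` limits the loss from the exponent `j - 1` to `4/3`. -/
theorem abs_pow_sub_pow_le_of_le_exp {a g q : ℝ} {j : ℕ} (hj : 1 ≤ j) (hq : 0 ≤ q) (ha : 0 ≤ a)
    (hg : 0 ≤ g) (ha' : 3 / 4 ≤ a) (hae : a ≤ Real.exp (-(2 / 5 * q)))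
    (hge : g ≤ Real.exp (-(2 / 5 * q))) (hag : |a - g| ≤ 2 * q ^ 2) :
    |a ^ j - g ^ j| ≤ 1200 * (1 / j * Real.exp (-(1 / 3 * (j * q)))) := by
  have hjpos : (0 : ℝ) < j := by exact_mod_cast hj
  have hy := sq_mul_exp_neg_le (y := j * q) (by positivity)
  have hepow : Real.exp (-(2 / 5 * (j * q))) = Real.exp (-(2 / 5 * q)) ^ j := by
    rw [← Real.exp_nat_mul]
    ring_nf
  rw [hepow] at hy
  obtain ⟨e, he⟩ : ∃ e, e = Real.exp (-(2 / 5 * q)) := ⟨_, rfl⟩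
  rw [← he] at hae hge hy
  have hmax : max |a| |g| ≤ e := by
    rw [abs_of_nonneg ha, abs_of_nonneg hg]
    exact max_le hae hge
  have he1 : 3 / 4 ≤ e := ha'.trans hae
  have hpred : e ^ (j - 1) ≤ 4 / 3 * e ^ j := by
    obtain ⟨i, rfl⟩ : ∃ i, j = i + 1 := ⟨j - 1, by omega⟩
    have hi : 0 ≤ e ^ i := pow_nonneg (by linarith) i
    have := mul_le_mul_of_nonneg_left he1 hi
    rw [Nat.add_sub_cancel, pow_succ]
    linarith
  calc |a ^ j - g ^ j| ≤ |a - g| * j * max |a| |g| ^ (j - 1) := abs_pow_sub_pow_le a g j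
    _ ≤ 2 * q ^ 2 * j * (4 / 3 * e ^ j) := by
        gcongr
        exact (pow_le_pow_left₀ (by positivity) hmax _).trans hpred
    _ = 8 / 3 / j * ((j * q) ^ 2 * e ^ j) := by field_simp; ring
    _ ≤ 8 / 3 / j * (450 * Real.exp (-(1 / 3 * (j * q)))) := by gcongr
    _ = _ := by ring

theorem exists_roots_of_abs_le_half {θ : ℝ} (hθ : |θ| ≤ 1 / 2) :
    ∃ a b : ℝ, a + b = 1 / 4 + Real.cos θ ∧ a * b = 1 / 4 ∧ 4 / 5 ≤ a ∧ 0 ≤ b ∧ b ≤ 1 / 3 ∧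
      a ≤ Real.exp (-(2 / 5 * θ ^ 2)) ∧ |a - Real.exp (-(2 / 3 * θ ^ 2))| ≤ 2 * (θ ^ 2) ^ 2 ∧
      |(initSymbol θ - a / 2) / (a - b)| ≤ 5 / 2 * θ ^ 2 := by
  have hsq : θ ^ 2 ≤ 1 / 4 := by
    rw [← sq_abs]
    nlinarith [abs_nonneg θ]
  have hsq0 := sq_nonneg θ
  have hcos1 := Real.one_sub_sq_div_two_le_cos (x := θ)
  have hcos2 := Real.cos_bound (x := θ) (by linarith)
  have hinit := abs_le.1 (abs_initSymbol_sub_half_le θ)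
  rw [show |θ| ^ 4 = (|θ| ^ 2) ^ 2 by ring, sq_abs] at hcos2
  obtain ⟨q, hq⟩ : ∃ q, q = θ ^ 2 := ⟨_, rfl⟩
  obtain ⟨κ, hκ⟩ : ∃ κ, κ = 1 - Real.cos θ := ⟨_, rfl⟩
  rw [← hq] at hsq hsq0 hcos1 hcos2 ⊢
  rw [← hκ] at hinit
  have hκ0 : 0 ≤ κ := by linarith [Real.cos_le_one θ]
  have hκ1 : κ ≤ q / 2 := by linarith
  have hκ2 : q / 2 - κ ≤ q ^ 2 * (5 / 96) := by linarith [(abs_le.1 hcos2).2]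
  -- Here `κ = q/2 + O(q²)`; the rate `2/5` lies below `1/2` to absorb the correction.
  have hκ3 : 2 / 5 * q ≤ κ := by nlinarith
  obtain ⟨a, b, hab, hmul, ha, hb0, hb1, haκ, haκ', hquad⟩ :=
    exists_real_roots hκ0 (by linarith)
  refine ⟨a, b, by linarith, hmul, ha, hb0, hb1, ?_, ?_, ?_⟩
  · linarith [Real.add_one_le_exp (-(2 / 5 * q))]
  · have h := Real.abs_exp_sub_one_sub_id_le (x := -(2 / 3 * q)) (by
      rw [abs_neg, abs_of_nonneg (by positivity)]
      linarith)
    rw [neg_sq, mul_pow] at h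
    obtain ⟨h1, h2⟩ := abs_le.1 h
    obtain ⟨h3, h4⟩ := abs_le.1 hquad
    have hκq : κ ^ 2 ≤ q ^ 2 / 4 := by nlinarith
    have hq2 := sq_nonneg q
    rw [abs_le]
    constructor <;> linarith
  · have hdiff : 7 / 15 ≤ a - b := by linarith
    rw [abs_div, abs_of_pos (show 0 < a - b by linarith), div_le_iff₀ (by linarith)]
    have hnum : |initSymbol θ - a / 2| ≤ 2 * κ :=
      abs_le.2 ⟨by linarith [hinit.1], by linarith [hinit.2]⟩
    nlinarith

theorem abs_symbol_sub_gaussian_le_of_abs_le {θ : ℝ} (hθ : |θ| ≤ 1 / 2) {j : ℕ} (hj : 1 ≤ j) :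
    |symbol j θ - 1 / 2 * Real.exp (-(2 / 3 * (j * θ ^ 2)))| ≤
      1000 / j * Real.exp (-(1 / 3 * (j * θ ^ 2))) + (9 / 10) ^ j := by
  have hjpos : (0 : ℝ) < j := by exact_mod_cast hj
  have hsq : θ ^ 2 ≤ 1 / 4 := by
    rw [← sq_abs]
    nlinarith [abs_nonneg θ]
  obtain ⟨a, b, hab, hmul, ha, hb0, hb1, hae, hag, hcoef⟩ := exists_roots_of_abs_le_half hθ
  have hne : a - b ≠ 0 := by linarith
  rw [symbol_eq_of_roots hab hmul hne j]
  generalize (initSymbol θ - a / 2) / (a - b) = K at hcoef ⊢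
  have hq0 := sq_nonneg θ
  generalize θ ^ 2 = q at *
  have hgpow : Real.exp (-(2 / 3 * (j * q))) = Real.exp (-(2 / 3 * q)) ^ j := by
    rw [← Real.exp_nat_mul]
    ring_nf
  have hepow : Real.exp (-(2 / 5 * (j * q))) = Real.exp (-(2 / 5 * q)) ^ j := by
    rw [← Real.exp_nat_mul]
    ring_nf
  have hpowdiff := abs_pow_sub_pow_le_of_le_exp hj hq0 (by linarith) (Real.exp_pos _).le
    (by linarith) hae (Real.exp_le_exp.2 (by linarith)) hag
  have hterm1 : |K * a ^ j| ≤ 75 / 2 * (1 / j * Real.exp (-(1 / 3 * (j * q)))) := by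
    have h4 := mul_exp_neg_le (j * q)
    rw [hepow] at h4
    have ha0 : 0 ≤ a := by linarith
    rw [abs_mul, abs_of_nonneg (pow_nonneg ha0 j)]
    calc |K| * a ^ j ≤ 5 / 2 * q * Real.exp (-(2 / 5 * q)) ^ j := by gcongr
      _ = 5 / 2 / j * (j * q * Real.exp (-(2 / 5 * q)) ^ j) := by field_simp
      _ ≤ 5 / 2 / j * (15 * Real.exp (-(1 / 3 * (j * q)))) := by gcongr
      _ = _ := by ring
  have hterm2 : |K * b ^ j| ≤ (9 / 10) ^ j := by
    rw [abs_mul, abs_of_nonneg (pow_nonneg hb0 j)]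
    have hK : |K| ≤ 1 := by linarith
    have hb : b ≤ 9 / 10 := by linarith
    calc |K| * b ^ j ≤ 1 * (9 / 10) ^ j := by gcongr
      _ = _ := one_mul _
  have hE : 0 ≤ 1 / (j : ℝ) * Real.exp (-(1 / 3 * (j * q))) := by positivity
  rw [hgpow, show 1000 / (j : ℝ) * Real.exp (-(1 / 3 * (j * q))) =
    1000 * (1 / (j : ℝ) * Real.exp (-(1 / 3 * (j * q)))) by ring]
  obtain ⟨h1, h2⟩ := abs_le.1 hpowdiff
  obtain ⟨h3, h4⟩ := abs_le.1 hterm1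
  obtain ⟨h5, h6⟩ := abs_le.1 hterm2
  rw [abs_le]
  constructor <;> linarith

/-- Away from `0` the Gaussian is itself an error term: `jθ²/3 ≥ j/12`, hence `exp (jθ²/3) ≥ j/12`.
-/
theorem exp_neg_le_of_half_le {θ : ℝ} (hθ : 1 / 2 ≤ |θ|) {j : ℕ} (hj : 1 ≤ j) :
    Real.exp (-(2 / 3 * (j * θ ^ 2))) ≤ 12 / j * Real.exp (-(1 / 3 * (j * θ ^ 2))) := by
  have hjpos : (0 : ℝ) < j := by exact_mod_cast hj
  have hsq : 1 / 4 ≤ θ ^ 2 := by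
    rw [← sq_abs]
    nlinarith
  have h := Real.add_one_le_exp (1 / 3 * (j * θ ^ 2))
  have hE : Real.exp (-(1 / 3 * (j * θ ^ 2))) =
      Real.exp (1 / 3 * (j * θ ^ 2)) * Real.exp (-(2 / 3 * (j * θ ^ 2))) := by
    rw [← Real.exp_add]
    ring_nf
  rw [hE, ← mul_assoc (12 / (j : ℝ))]
  refine le_mul_of_one_le_left (Real.exp_pos _).le ?_
  rw [div_mul_eq_mul_div, le_div_iff₀ hjpos]
  nlinarith

/-- Approximation of `symbol j` by a Gaussian on a full period. -/
theorem abs_symbol_sub_gaussian_le {θ : ℝ} (hθ : |θ| ≤ Real.pi) {j : ℕ} (hj : 1 ≤ j) :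
    |symbol j θ - 1 / 2 * Real.exp (-(2 / 3 * (j * θ ^ 2)))| ≤
      1000 / j * Real.exp (-(1 / 3 * (j * θ ^ 2))) + (9 / 10) ^ j * (1 / 2 + 2 * j) := by
  have hj1 : (1 : ℝ) ≤ j := by exact_mod_cast hj
  rcases le_or_gt |θ| (1 / 2) with h | h
  · refine (abs_symbol_sub_gaussian_le_of_abs_le h hj).trans ?_
    gcongr
    exact le_mul_of_one_le_right (by positivity) (by linarith)
  -- The threshold `1/2` works because `cos (1/2) < 9/10`.
  · have hcos : Real.cos θ ≤ 9 / 10 := by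
      rw [← Real.cos_abs]
      refine (Real.cos_le_cos_of_nonneg_of_le_pi (by norm_num) hθ h.le).trans ?_
      have := (abs_le.1 (Real.cos_bound (x := 1 / 2) (by norm_num [abs_of_pos]))).2
      rw [abs_of_pos (by norm_num : (0 : ℝ) < 1 / 2)] at this
      linarith
    have h1 := abs_symbol_le_of_cos_le hcos j
    have h2 := exp_neg_le_of_half_le h.le hj
    have h3 : 12 / (j : ℝ) * Real.exp (-(1 / 3 * (j * θ ^ 2))) ≤
        1000 / j * Real.exp (-(1 / 3 * (j * θ ^ 2))) := by
      gcongr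
      norm_num
    have h4 := Real.exp_pos (-(2 / 3 * (j * θ ^ 2)))
    obtain ⟨h5, h6⟩ := abs_le.1 h1
    rw [abs_le]
    constructor <;> linarith

/-! ### Integration and the error term -/

open MeasureTheory in
theorem abs_integral_symbol_sub_le {j : ℕ} (hj : 1 ≤ j) :
    |(∫ θ in -Real.pi..Real.pi, symbol j θ) - 1 / 2 * Real.sqrt (Real.pi / (2 / 3 * j))| ≤
      1000 / j * Real.sqrt (Real.pi / (1 / 3 * j)) +
        2 * Real.pi * ((9 / 10) ^ j * (1 / 2 + 2 * j)) := by
  have hjpos : (0 : ℝ) < j := by exact_mod_cast hj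
  obtain ⟨T, hT⟩ : ∃ T : ℝ, T = (9 / 10) ^ j * (1 / 2 + 2 * j) := ⟨_, rfl⟩
  have hpi : -Real.pi ≤ Real.pi := by linarith [Real.pi_pos]
  set S := Set.Ioc (-Real.pi) Real.pi with hS
  have hSm : MeasurableSet S := measurableSet_Ioc
  have hf : Integrable (S.indicator (symbol j)) := by
    rw [integrable_indicator_iff hSm]
    exact ((continuous_symbol j).integrableOn_Icc).mono_set Set.Ioc_subset_Icc_self
  have hg : Integrable fun θ : ℝ => 1 / 2 * Real.exp (-(2 / 3 * j) * θ ^ 2) :=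
    (integrable_exp_neg_mul_sq (by positivity)).const_mul _
  have hB1 : Integrable fun θ : ℝ => 1000 / j * Real.exp (-(1 / 3 * j) * θ ^ 2) :=
    (integrable_exp_neg_mul_sq (by positivity)).const_mul _
  have hB2 : Integrable (S.indicator fun _ : ℝ => T) := by
    rw [integrable_indicator_iff hSm]
    exact integrableOn_const (by simp [hS])
  have hB2i : ∫ θ, S.indicator (fun _ : ℝ => T) θ = 2 * Real.pi * T := by
    rw [integral_indicator hSm, hS, setIntegral_const, smul_eq_mul, Measure.real,
      Real.volume_Ioc, ENNReal.toReal_ofReal (by linarith)]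
    ring
  -- Extending the symbol by zero moves the comparison to the whole line, where both Gaussians have
  -- exact integrals.
  have hkey : ‖∫ θ, (S.indicator (symbol j) θ - 1 / 2 * Real.exp (-(2 / 3 * j) * θ ^ 2))‖ ≤
      ∫ θ, (1000 / j * Real.exp (-(1 / 3 * j) * θ ^ 2) + S.indicator (fun _ : ℝ => T) θ) := by
    refine norm_integral_le_of_norm_le (hB1.add hB2) (Eventually.of_forall fun θ => ?_)
    rw [Real.norm_eq_abs, show -(2 / 3 * (j : ℝ)) * θ ^ 2 = -(2 / 3 * (j * θ ^ 2)) by ring,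
      show -(1 / 3 * (j : ℝ)) * θ ^ 2 = -(1 / 3 * (j * θ ^ 2)) by ring]
    by_cases h : θ ∈ S
    · rw [Set.indicator_of_mem h, Set.indicator_of_mem h, hT]
      exact abs_symbol_sub_gaussian_le (abs_le.2 ⟨h.1.le, h.2⟩) hj
    · rw [Set.indicator_of_notMem h, Set.indicator_of_notMem h, zero_sub, abs_neg, add_zero,
        abs_of_nonneg (by positivity)]
      have hθ : 1 / 2 ≤ |θ| := by
        by_contra! hlt
        have := abs_lt.1 hlt
        exact h ⟨by linarith [Real.pi_gt_three], by linarith [Real.pi_gt_three]⟩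
      have h2 := exp_neg_le_of_half_le hθ hj
      have h3 : 12 / (j : ℝ) * Real.exp (-(1 / 3 * (j * θ ^ 2))) ≤
          1000 / j * Real.exp (-(1 / 3 * (j * θ ^ 2))) := by
        gcongr
        norm_num
      have h4 := Real.exp_pos (-(2 / 3 * (j * θ ^ 2)))
      linarith
  rw [integral_sub hf hg, integral_add hB1 hB2, integral_indicator hSm, hB2i, integral_const_mul,
    integral_const_mul, integral_gaussian, integral_gaussian, hS,
    ← intervalIntegral.integral_of_le hpi, hT] at hkey
  exact hkey

theorem exists_geometric_le_rpow :
    ∃ C : ℝ, 0 ≤ C ∧ ∀ j : ℕ, 1 ≤ j →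
      (9 / 10 : ℝ) ^ j * (1 / 2 + 2 * j) ≤ C * (j : ℝ) ^ (-(3 / 2) : ℝ) := by
  have h := tendsto_pow_const_mul_const_pow_of_abs_lt_one 3
    (show |(9 / 10 : ℝ)| < 1 by rw [abs_lt]; constructor <;> norm_num)
  obtain ⟨C, hC⟩ := h.bddAbove_range
  have hC' : ∀ j : ℕ, (j : ℝ) ^ 3 * (9 / 10) ^ j ≤ C := fun j => hC ⟨j, rfl⟩
  have hC0 : 0 ≤ C := le_trans (by norm_num) (hC' 0)
  refine ⟨3 * C, by positivity, fun j hj => ?_⟩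
  have hj1 : (1 : ℝ) ≤ j := by exact_mod_cast hj
  have hjpos : (0 : ℝ) < j := by linarith
  have h1 : (j : ℝ) ^ (-2 : ℝ) ≤ (j : ℝ) ^ (-(3 / 2) : ℝ) :=
    Real.rpow_le_rpow_of_exponent_le hj1 (by norm_num)
  have h2 : (j : ℝ) ^ (-2 : ℝ) = ((j : ℝ) ^ 2)⁻¹ := by
    rw [Real.rpow_neg hjpos.le]
    norm_num
  calc (9 / 10 : ℝ) ^ j * (1 / 2 + 2 * j) ≤ (9 / 10) ^ j * (3 * j) := by
        gcongr
        linarith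
    _ = 3 * ((j : ℝ) ^ 3 * (9 / 10) ^ j) * ((j : ℝ) ^ 2)⁻¹ := by field_simp
    _ ≤ 3 * C * ((j : ℝ) ^ 2)⁻¹ := by
        gcongr
        exact hC' j
    _ ≤ 3 * C * (j : ℝ) ^ (-(3 / 2) : ℝ) := by
        rw [← h2]
        gcongr

theorem gaussian_mass_eq {x : ℝ} (hx : 0 < x) :
    1 / 2 * Real.sqrt (Real.pi / (2 / 3 * x)) =
      2 * Real.pi * (Real.sqrt 3 / (4 * Real.sqrt (2 * Real.pi * x))) := by
  have hpi := Real.pi_pos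
  have h : Real.sqrt (Real.pi / (2 / 3 * x)) * Real.sqrt (2 * Real.pi * x) =
      Real.pi * Real.sqrt 3 := by
    rw [← Real.sqrt_mul (by positivity), show Real.pi / (2 / 3 * x) * (2 * Real.pi * x) =
      Real.pi ^ 2 * 3 by field_simp, Real.sqrt_mul (by positivity), Real.sqrt_sq hpi.le]
  have hpos : 0 < Real.sqrt (2 * Real.pi * x) := Real.sqrt_pos.2 (by positivity)
  generalize Real.sqrt (Real.pi / (2 / 3 * x)) = m at h ⊢
  field_simp
  linarith

theorem exists_abs_cusickDensity_tSeq_sub_le :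
    ∃ C : ℝ, ∀ j : ℕ, 1 ≤ j →
      |cusickDensity (tSeq j) -
          (1 / 2 + Real.sqrt 3 / (4 * Real.sqrt (2 * Real.pi * (j : ℝ))))| ≤
        C * (j : ℝ) ^ (-(3 / 2) : ℝ) := by
  obtain ⟨C, hC0, hC⟩ := exists_geometric_le_rpow
  refine ⟨1000 * Real.sqrt (3 * Real.pi) / (2 * Real.pi) + C, fun j hj => ?_⟩
  have hpi := Real.pi_pos
  have hjpos : (0 : ℝ) < j := by exact_mod_cast hj
  have h := abs_integral_symbol_sub_le hj
  rw [integral_symbol, gaussian_mass_eq hjpos, ← mul_sub, abs_mul,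
    abs_of_pos (by positivity : 0 < 2 * Real.pi)] at h
  have hsqrt : 1000 / (j : ℝ) * Real.sqrt (Real.pi / (1 / 3 * j)) =
      1000 * Real.sqrt (3 * Real.pi) * (j : ℝ) ^ (-(3 / 2) : ℝ) := by
    rw [show Real.pi / (1 / 3 * (j : ℝ)) = 3 * Real.pi / j by field_simp,
      Real.sqrt_div (by positivity), Real.sqrt_eq_rpow (j : ℝ),
      show (-(3 / 2) : ℝ) = -1 + -(1 / 2) by norm_num, Real.rpow_add hjpos,
      Real.rpow_neg hjpos.le, Real.rpow_neg hjpos.le, Real.rpow_one]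
    ring
  rw [hsqrt] at h
  rw [← sub_sub]
  have h2 := hC j hj
  rw [← mul_le_mul_iff_right₀ (by positivity : 0 < 2 * Real.pi)]
  refine h.trans ?_
  calc _ ≤ 1000 * Real.sqrt (3 * Real.pi) * (j : ℝ) ^ (-(3 / 2) : ℝ) +
        2 * Real.pi * (C * (j : ℝ) ^ (-(3 / 2) : ℝ)) := by gcongr
    _ = _ := by field_simp

theorem theorem2 :
    -- the densities `c_t` exist
    (∀ t : ℕ, HasDensity (cusickSet t) (cusickDensity t)) ∧
    -- `t_j` has the binary representation `(10)^(j-1) 1` (most significant digit first)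
    (∀ j : ℕ, 1 ≤ j →
      (Nat.digits 2 (tSeq j)).reverse = (List.replicate (j - 1) [1, 0]).flatten ++ [1]) ∧
    -- `c_{t_j} = 1/2 + √3 / (4 √(2πj)) + O(j^(-3/2))`
    (∃ C : ℝ, ∀ j : ℕ, 1 ≤ j →
      |cusickDensity (tSeq j) -
          (1 / 2 + Real.sqrt 3 / (4 * Real.sqrt (2 * Real.pi * (j : ℝ))))| ≤
        C * (j : ℝ) ^ (-(3 / 2) : ℝ)) ∧
    -- `c_{t_j} > 1/2`
    (∀ j : ℕ, 1 ≤ j → cusickDensity (tSeq j) > 1 / 2) := by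
  refine ⟨fun t => ?_, fun j hj => ?_, exists_abs_cusickDensity_tSeq_sub_le, fun j hj => ?_⟩
  · rw [cusickDensity, cusickSet_eq_diffSet]
    exact hasDensity_diffSet 0 t
  · obtain ⟨i, rfl⟩ : ∃ i, j = i + 1 := ⟨j - 1, by omega⟩
    exact reverse_digits_tSeq_succ i
  · obtain ⟨i, rfl⟩ : ∃ i, j = i + 1 := ⟨j - 1, by omega⟩
    exact half_lt_cusickDensity_tSeq_succ i
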